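/- Let $W=\mathfrak S_2\ltimes\mathbb Z^2$ act on the right on $I=\mathbb Z^2$ by $\underline i\cdot(\sigma,\varepsilon)=(i_{\sigma(1)}+2\varepsilon_1,\ i_{\sigma(2)}+2\varepsilon_2)$ and diagonally on $I\times I$. Let $S=S_\vartriangle(2,2)$ be the affine Schur algebra over $\mathbb Q$: it has a $\mathbb Q$-basis of elements $\xi_{\underline i,\underline j}$, one for each $W$-orbit in $I\times I$ (so $\xi_{\underline i,\underline j}=\xi_{\underline k,\underline l}$ exactly when $(\underline i,\underline j)$ and $(\underline k,\underline l)$ lie in the same orbit, written $(\underline i,\underline j)\sim(\underline k,\underline l)$), and its multiplication is given by $$\xi_{\underline i,\underline j}\,\xi_{\underline k,\underline l}=\sum_{(\underline p,\underline q)\in (I\times I)/W}\bigl|\{\underline s\in I : (\underline i,\underline j)\sim(\underline p,\underline s),\ (\underline s,\underline q)\sim(\underline k,\underline l)\}\bigr|\ \xi_{\underline p,\underline q}.$$ Let $\lambda=(2,0)$, let $e_\lambda=\xi_{(1,1),(1,1)}\in S$ be the corresponding idempotent, let $B=e_\lambda S e_\lambda$, and let $J=Se_\lambda S$ be the two-sided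 ideal of $S$ generated by $e_\lambda$. Then the multiplication map $$S e_\lambda\otimes_B e_\lambda S\longrightarrow S e_\lambda S,\qquad x\otimes y\longmapsto xy,$$ is an isomorphism of $S$-bimodules. Moreover, $J$ is projective as a left $S$-module and as a right $S$-module. -/

import Mathlib

open scoped TensorProduct

/-! ### The affine Schur algebra over the rationals -/

namespace AffSchur

/-- The set `I(ℤ, r)` of `r`-tuples of integers. -/
abbrev Tup (r : ℕ) : Type := Fin r → ℤ

/-- The right action of the element `(σ, ε)` of the extended affine Weyl group `𝔖_r ⋉ ℤ^r` on
`I(ℤ, r)`: `σ` acts by place permutation and `ε` by the shift by `n ε`. -/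
def act (n : ℕ) {r : ℕ} (σ : Equiv.Perm (Fin r)) (ε : Fin r → ℤ) (i : Tup r) : Tup r :=
  fun t => i (σ t) + (n : ℤ) * ε t

/-- The relation "being in the same orbit of `𝔖_r ⋉ ℤ^r`" for the diagonal action on
`I(ℤ, r) × I(ℤ, r)`. -/
def orbitRel (n r : ℕ) : Setoid (Tup r × Tup r) where
  r x y := ∃ (σ : Equiv.Perm (Fin r)) (ε : Fin r → ℤ),
    y.1 = act n σ ε x.1 ∧ y.2 = act n σ ε x.2
  iseqv := by
    refine ⟨fun x => ⟨1, 0, ?_, ?_⟩, ?_, ?_⟩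
    · funext t; simp [act]
    · funext t; simp [act]
    · rintro x y ⟨σ, ε, h1, h2⟩
      refine ⟨σ⁻¹, fun t => -ε (σ⁻¹ t), ?_, ?_⟩
      · funext t; simp [act, h1]
      · funext t; simp [act, h2]
    · rintro x y z ⟨σ, ε, h1, h2⟩ ⟨σ', ε', h3, h4⟩
      refine ⟨σ * σ', fun t => ε (σ' t) + ε' t, ?_, ?_⟩
      · funext t; simp [act, h1, h3]; ring
      · funext t; simp [act, h2, h4]; ring

/-- The set of orbits `(I(ℤ, r) × I(ℤ, r)) / (𝔖_r ⋉ ℤ^r)`. -/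
def Orb (n r : ℕ) : Type := Quotient (orbitRel n r)

/-- The orbit of the pair `(i, j)`. -/
def orb (n : ℕ) {r : ℕ} (i j : Tup r) : Orb n r := Quotient.mk (orbitRel n r) (i, j)

variable {n r : ℕ}

theorem orb_eq_iff {i j k l : Tup r} : orb n i j = orb n k l ↔
    ∃ (σ : Equiv.Perm (Fin r)) (ε : Fin r → ℤ), k = act n σ ε i ∧ l = act n σ ε j :=
  Quotient.eq (r := orbitRel n r)

theorem orb_act (σ : Equiv.Perm (Fin r)) (ε : Fin r → ℤ) (i j : Tup r) :
    orb n (act n σ ε i) (act n σ ε j) = orb n i j :=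
  (orb_eq_iff.2 ⟨σ, ε, rfl, rfl⟩).symm

theorem act_bijective (σ : Equiv.Perm (Fin r)) (ε : Fin r → ℤ) :
    Function.Bijective (act n σ ε) := by
  constructor
  · intro i j h
    funext t
    have := congrFun h (σ⁻¹ t)
    simpa [act] using this
  · intro j
    refine ⟨fun t => j (σ⁻¹ t) - n * ε (σ⁻¹ t), ?_⟩
    funext t; simp [act]

theorem orb_ind {P : Orb n r → Prop} (h : ∀ i j, P (orb n i j)) (c : Orb n r) : P c :=
  Quotient.ind (fun x => h x.1 x.2) c

theorem finite_left (q : Tup r) (b : Orb n r) : {s : Tup r | orb n s q = b}.Finite := by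
  induction b using orb_ind with
  | h k l =>
    refine (Set.finite_range
      (fun σ : Equiv.Perm (Fin r) => fun t => k (σ t) + (q t - l (σ t)))).subset ?_
    intro s hs
    obtain ⟨σ, ε, h1, h2⟩ := orb_eq_iff.1 (Eq.symm hs)
    refine ⟨σ, ?_⟩
    funext t; simp [h1, h2, act]

theorem finite_right (p : Tup r) (a : Orb n r) : {s : Tup r | orb n p s = a}.Finite := by
  induction a using orb_ind with
  | h k l =>
    refine (Set.finite_range
      (fun σ : Equiv.Perm (Fin r) => fun t => l (σ t) + (p t - k (σ t)))).subset ?_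
    intro s hs
    obtain ⟨σ, ε, h1, h2⟩ := orb_eq_iff.1 (Eq.symm hs)
    refine ⟨σ, ?_⟩
    funext t; simp [h1, h2, act]

/-- The structure constant `C(a, b, c)`: if `a`, `b`, `c` are the orbits of `(i, j)`, `(k, l)` and
`(p, q)`, it is the number of `s ∈ I(ℤ, r)` with `(p, s) ∼ (i, j)` and `(s, q) ∼ (k, l)`. -/
noncomputable def structConst (a b c : Orb n r) : ℕ :=
  Quotient.liftOn c (fun x => Set.ncard {s : Tup r | orb n x.1 s = a ∧ orb n s x.2 = b}) (by
    rintro x y ⟨σ, ε, h1, h2⟩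
    rw [h1, h2, ← Set.ncard_image_of_injective _ (act_bijective (n := n) σ ε).1]
    congr 1
    ext s
    obtain ⟨s, rfl⟩ := (act_bijective (n := n) σ ε).2 s
    simp only [Set.mem_image, Set.mem_ofPred_eq, orb_act]
    constructor
    · rintro ⟨u, hu, hus⟩
      rwa [← (act_bijective (n := n) σ ε).1 hus]
    · intro h
      exact ⟨s, h, rfl⟩)

theorem structConst_orb (a b : Orb n r) (p q : Tup r) :
    structConst a b (orb n p q) = Set.ncard {s : Tup r | orb n p s = a ∧ orb n s q = b} := rfl

theorem finite_structConst (a b : Orb n r) : {c : Orb n r | structConst a b c ≠ 0}.Finite := by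
  induction a using orb_ind with
  | h i j =>
    refine ((finite_right (n := n) j b).image (fun q => orb n i q)).subset ?_
    intro c hc
    induction c using orb_ind with
    | h p q =>
      rw [Set.mem_ofPred_eq, structConst_orb] at hc
      obtain ⟨s, hs1, hs2⟩ := Set.nonempty_of_ncard_ne_zero hc
      obtain ⟨σ, ε, h1, h2⟩ := orb_eq_iff.1 hs1
      obtain ⟨q', hq'⟩ := (act_bijective (n := n) σ ε).2 q
      subst h1 h2
      refine ⟨act n σ ε q, ?_, ?_⟩
      · rw [Set.mem_ofPred_eq, orb_act]; exact hs2
      · exact orb_act σ ε p q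

end AffSchur

open AffSchur in
/-- The affine Schur algebra `S_△(n, r)` over `ℚ`: the `ℚ`-vector space with basis the elements
`ξ_{i,j}`, one for each orbit of `𝔖_r ⋉ ℤ^r` on `I(ℤ, r) × I(ℤ, r)`. Its product is below. -/
def AffineSchur (n r : ℕ) : Type := Orb n r →₀ ℚ

namespace AffineSchur

open AffSchur

variable {n r : ℕ}

noncomputable instance : AddCommGroup (AffineSchur n r) :=
  inferInstanceAs (AddCommGroup (Orb n r →₀ ℚ))

noncomputable instance : Module ℚ (AffineSchur n r) :=
  inferInstanceAs (Module ℚ (Orb n r →₀ ℚ))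

/-- The coefficient of an element at the basis vector of an orbit. -/
def coeff (f : AffineSchur n r) (c : Orb n r) : ℚ := Finsupp.toFun f c

/-- The finite set of orbits at which an element has a nonzero coefficient. -/
def supp (f : AffineSchur n r) : Finset (Orb n r) := Finsupp.support f

/-- The element with given finitely supported coefficients. -/
noncomputable def ofCoeff (F : Orb n r → ℚ) (h : (Function.support F).Finite) : AffineSchur n r :=
  Finsupp.ofSupportFinite F h

/-- The basis element `ξ_{i,j}`. -/
noncomputable def xi (i j : Tup r) : AffineSchur n r := Finsupp.single (orb n i j) 1

theorem coeff_ofCoeff (F : Orb n r → ℚ) (h) (c : Orb n r) : (ofCoeff F h).coeff c = F c := rfl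

theorem mem_supp {f : AffineSchur n r} {c : Orb n r} : c ∈ f.supp ↔ f.coeff c ≠ 0 :=
  Finsupp.mem_support_iff

theorem ext_coeff {f g : AffineSchur n r} (h : ∀ c, f.coeff c = g.coeff c) : f = g :=
  Finsupp.ext h

theorem coeff_add (f g : AffineSchur n r) (c : Orb n r) :
    (f + g).coeff c = f.coeff c + g.coeff c := rfl

theorem coeff_zero (c : Orb n r) : (0 : AffineSchur n r).coeff c = 0 := rfl

theorem coeff_smul (x : ℚ) (f : AffineSchur n r) (c : Orb n r) :
    (x • f).coeff c = x * f.coeff c := rfl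

open Classical in
theorem coeff_xi (i j : Tup r) (c : Orb n r) :
    (xi i j : AffineSchur n r).coeff c = if orb n i j = c then 1 else 0 := by
  exact Finsupp.single_apply

/-- The product, the bilinear extension of `ξ_a ξ_b = ∑_c C(a, b, c) ξ_c`. -/
noncomputable instance : Mul (AffineSchur n r) where
  mul f g := ofCoeff
    (fun c => ∑ a ∈ f.supp, ∑ b ∈ g.supp, f.coeff a * g.coeff b * (structConst a b c : ℚ)) (by
      refine (Set.Finite.biUnion f.supp.finite_toSet fun a _ =>
        Set.Finite.biUnion g.supp.finite_toSet fun b _ => finite_structConst a b).subset ?_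
      intro c hc
      obtain ⟨a, ha, hc⟩ := Finset.exists_ne_zero_of_sum_ne_zero hc
      obtain ⟨b, hb, hc⟩ := Finset.exists_ne_zero_of_sum_ne_zero hc
      simp only [Set.mem_iUnion]
      exact ⟨a, ha, b, hb, fun h => hc (by rw [h]; simp)⟩)

theorem coeff_mul (f g : AffineSchur n r) (c : Orb n r) : (f * g).coeff c =
    ∑ a ∈ f.supp, ∑ b ∈ g.supp, f.coeff a * g.coeff b * (structConst a b c : ℚ) := rfl

open Classical in
/-- The unit: the sum of the `ξ_{i,i}` over the distinct orbits of pairs `(i, i)`. -/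
noncomputable instance [NeZero n] : One (AffineSchur n r) where
  one := ofCoeff (fun c => if ∃ i, c = orb n i i then 1 else 0) (by
    refine (Set.finite_range
      (fun v : Fin r → Fin n => orb n (fun t => (v t : ℤ)) (fun t => (v t : ℤ)))).subset ?_
    intro c hc
    have hc : ∃ i, c = orb n i i := by
      by_contra h
      exact hc (if_neg h)
    obtain ⟨i, rfl⟩ := hc
    have hn : (0 : ℤ) < n := by exact_mod_cast Nat.pos_of_ne_zero (NeZero.ne n)
    refine ⟨fun t => ⟨(i t % n).toNat, ?_⟩, ?_⟩
    · have h1 := Int.emod_nonneg (i t) hn.ne'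
      have h2 := Int.emod_lt_of_pos (i t) hn
      omega
    · have h : i = act n 1 (fun t => i t / n) (fun t => (((i t % n).toNat : ℕ) : ℤ)) := by
        funext t
        have h1 := Int.emod_nonneg (i t) hn.ne'
        simp only [act, Equiv.Perm.coe_one, id_eq, Int.toNat_of_nonneg h1]
        exact (Int.emod_add_mul_ediv (i t) n).symm
      exact orb_eq_iff.2 ⟨_, _, h, h⟩)

open Classical in
theorem coeff_one [NeZero n] (p q : Tup r) :
    (1 : AffineSchur n r).coeff (orb n p q) = if p = q then 1 else 0 := by
  change (if ∃ i, orb n p q = orb n i i then (1 : ℚ) else 0) = _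
  refine if_congr ⟨?_, ?_⟩ rfl rfl
  · rintro ⟨i, hi⟩
    obtain ⟨σ, ε, h1, h2⟩ := orb_eq_iff.1 hi.symm
    rw [h1, h2]
  · rintro rfl
    exact ⟨p, rfl⟩

/-- An element read as the column `q` of a matrix with rows and columns indexed by `I(ℤ, r)`. -/
noncomputable def col (f : AffineSchur n r) (q : Tup r) : Tup r →₀ ℚ :=
  Finsupp.ofSupportFinite (fun p => f.coeff (orb n p q)) (by
    refine (Set.Finite.biUnion f.supp.finite_toSet fun b _ => finite_left q b).subset ?_
    intro p hp
    simp only [Set.mem_iUnion]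
    exact ⟨_, mem_supp.2 hp, rfl⟩)

theorem col_apply (f : AffineSchur n r) (p q : Tup r) : f.col q p = f.coeff (orb n p q) := rfl

/-- The action of an element on the `ℚ`-vector space with basis `I(ℤ, r)`. -/
noncomputable def toEnd (f : AffineSchur n r) : Module.End ℚ (Tup r →₀ ℚ) :=
  Finsupp.linearCombination ℚ f.col

theorem toEnd_single (f : AffineSchur n r) (q : Tup r) :
    f.toEnd (Finsupp.single q 1) = f.col q := by
  simp [toEnd]

theorem toEnd_injective : Function.Injective (toEnd : AffineSchur n r → _) := by
  intro f g h
  refine ext_coeff fun c => ?_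
  induction c using orb_ind with
  | h p q =>
    have := congrArg (fun φ : Module.End ℚ (Tup r →₀ ℚ) => φ (Finsupp.single q 1) p) h
    simpa only [toEnd_single, col_apply] using this

theorem toEnd_ext {f : AffineSchur n r} {φ : Module.End ℚ (Tup r →₀ ℚ)}
    (h : ∀ p q, f.coeff (orb n p q) = φ (Finsupp.single q 1) p) : f.toEnd = φ := by
  refine Finsupp.lhom_ext' fun q => LinearMap.ext_ring ?_
  ext p
  simp only [LinearMap.comp_apply, Finsupp.lsingle_apply, toEnd_single, col_apply, h]

theorem toEnd_add (f g : AffineSchur n r) : (f + g).toEnd = f.toEnd + g.toEnd :=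
  toEnd_ext fun p q => by
    simp [toEnd_single, col_apply, coeff_add]

theorem toEnd_zero : (0 : AffineSchur n r).toEnd = 0 :=
  toEnd_ext fun p q => by simp [coeff_zero]

theorem toEnd_smul (x : ℚ) (f : AffineSchur n r) : (x • f).toEnd = x • f.toEnd :=
  toEnd_ext fun p q => by
    simp [toEnd_single, col_apply, coeff_smul]

open Classical in
theorem toEnd_one [NeZero n] : (1 : AffineSchur n r).toEnd = 1 :=
  toEnd_ext fun p q => by
    rw [coeff_one, Module.End.one_apply, Finsupp.single_apply]
    exact if_congr eq_comm rfl rfl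

open Classical in
theorem toEnd_mul (f g : AffineSchur n r) : (f * g).toEnd = f.toEnd * g.toEnd :=
  toEnd_ext fun p q => by
    rw [Module.End.mul_apply, toEnd_single, toEnd, Finsupp.linearCombination_apply, Finsupp.sum,
      Finsupp.finsetSum_apply, coeff_mul]
    have key : ∀ a ∈ f.supp, ∀ b ∈ g.supp,
        f.coeff a * g.coeff b * (structConst a b (orb n p q) : ℚ) =
        ∑ s ∈ (g.col q).support, (if orb n p s = a then f.coeff a else 0) *
          (if orb n s q = b then g.coeff b else 0) := by
      intro a _ b hb
      have hset : {s : Tup r | orb n p s = a ∧ orb n s q = b} =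
          ↑((g.col q).support.filter fun s => orb n p s = a ∧ orb n s q = b) := by
        ext s
        simp only [Set.mem_ofPred_eq, Finset.coe_filter, Finsupp.mem_support_iff, col_apply]
        refine ⟨fun h => ⟨?_, h⟩, fun h => h.2⟩
        rw [h.2]
        exact mem_supp.1 hb
      rw [structConst_orb, hset, Set.ncard_coe_finset, Finset.card_filter, Nat.cast_sum,
        Finset.mul_sum]
      refine Finset.sum_congr rfl fun s _ => ?_
      by_cases h1 : orb n p s = a <;> by_cases h2 : orb n s q = b <;> simp [h1, h2]
    rw [Finset.sum_congr rfl fun a ha => Finset.sum_congr rfl fun b hb => key a ha b hb]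
    rw [Finset.sum_congr rfl fun a _ => Finset.sum_comm, Finset.sum_comm]
    refine Finset.sum_congr rfl fun s _ => ?_
    simp_rw [← Finset.mul_sum, ← Finset.sum_mul]
    rw [Finset.sum_ite_eq, Finset.sum_ite_eq, Finsupp.smul_apply, col_apply, col_apply,
      smul_eq_mul, mul_comm]
    congr 1
    · by_cases h : orb n s q ∈ g.supp
      · rw [if_pos h]
      · rw [if_neg h]; rw [mem_supp, not_not] at h; exact h.symm
    · by_cases h : orb n p s ∈ f.supp
      · rw [if_pos h]
      · rw [if_neg h]; rw [mem_supp, not_not] at h; exact h.symm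

noncomputable instance [NeZero n] : Ring (AffineSchur n r) where
  __ := (inferInstance : AddCommGroup (AffineSchur n r))
  left_distrib f g h := toEnd_injective (by simp only [toEnd_mul, toEnd_add, mul_add])
  right_distrib f g h := toEnd_injective (by simp only [toEnd_mul, toEnd_add, add_mul])
  zero_mul f := toEnd_injective (by simp only [toEnd_mul, toEnd_zero, zero_mul])
  mul_zero f := toEnd_injective (by simp only [toEnd_mul, toEnd_zero, mul_zero])
  mul_assoc f g h := toEnd_injective (by simp only [toEnd_mul, mul_assoc])
  one_mul f := toEnd_injective (by simp only [toEnd_mul, toEnd_one, one_mul])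
  mul_one f := toEnd_injective (by simp only [toEnd_mul, toEnd_one, mul_one])

noncomputable instance [NeZero n] : Algebra ℚ (AffineSchur n r) :=
  Algebra.ofModule
    (fun x f g => toEnd_injective (by simp only [toEnd_mul, toEnd_smul, smul_mul_assoc]))
    (fun x f g => toEnd_injective (by simp only [toEnd_mul, toEnd_smul, mul_smul_comm]))

/-- The product of two basis elements is given by the structure constants. -/
theorem coeff_xi_mul_xi (i j k l : Tup r) (c : Orb n r) :
    ((xi i j : AffineSchur n r) * xi k l).coeff c =
      (structConst (orb n i j) (orb n k l) c : ℚ) := by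
  classical
  have hs : ∀ i j : Tup r, (xi i j : AffineSchur n r).supp = {orb n i j} := fun i j =>
    Finsupp.support_single _ one_ne_zero
  rw [coeff_mul, hs, hs, Finset.sum_singleton, Finset.sum_singleton]
  simp [coeff_xi]

/-- `ξ_{i,i}` is idempotent. -/
theorem xi_self_idem (i : Tup r) : (xi i i : AffineSchur n r) * xi i i = xi i i := by
  classical
  refine ext_coeff fun c => ?_
  induction c using orb_ind with
  | h p q =>
    rw [coeff_xi_mul_xi, structConst_orb, coeff_xi]
    have hd : ∀ {u v : Tup r}, orb n u v = orb n i i → u = v := by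
      intro u v h
      obtain ⟨σ, ε, h1, h2⟩ := orb_eq_iff.1 h.symm
      rw [h1, h2]
    by_cases h : orb n p q = orb n i i
    · have hpq := hd h
      subst hpq
      have : {s : Tup r | orb n p s = orb n i i ∧ orb n s p = orb n i i} = {p} := by
        ext s
        simp only [Set.mem_ofPred_eq, Set.mem_singleton_iff]
        refine ⟨fun hs => hd hs.2, ?_⟩
        rintro rfl
        exact ⟨h, h⟩
      rw [this, if_pos h.symm]
      simp
    · have : {s : Tup r | orb n p s = orb n i i ∧ orb n s q = orb n i i} = ∅ := by
        ext s
        simp only [Set.mem_ofPred_eq, Set.mem_empty_iff_false, iff_false]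
        rintro ⟨h1, h2⟩
        have h3 := hd h1
        subst h3
        exact h h2
      rw [this, if_neg fun h' => h h'.symm]
      simp

/-- The idempotent `e_λ` of `S_△(2, 2)` for `λ = (2, 0)`, that is, `ξ_{i,i}` for the tuple
`i = (1, 1)`, with two entries `1` and no entry `2`. -/
noncomputable def eLam : AffineSchur 2 2 := xi ![1, 1] ![1, 1]

theorem eLam_idem : IsIdempotentElem eLam := xi_self_idem _

/-- The ring `B = e_λ S e_λ` for `S = S_△(2, 2)`. -/
abbrev B : Type := eLam_idem.Corner

/-- The two-sided ideal `J = S e_λ S` generated by `e_λ` in `S = S_△(2, 2)`. -/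
noncomputable abbrev J : TwoSidedIdeal (AffineSchur 2 2) := TwoSidedIdeal.span {eLam}

end AffineSchur

/-! ### Tensor products of bimodules over a ring that need not be commutative -/

section BalancedTensor

open MulOpposite

variable (A : Type*) [Ring A] (M N : Type*) [AddCommGroup M] [AddCommGroup N]
  [Module Aᵐᵒᵖ M] [Module A N]

/-- The relations `m a ⊗ n = m ⊗ a n` for a right module `M` and a left module `N` over `A`. -/
def balancedRel : AddSubgroup (M ⊗[ℤ] N) :=
  AddSubgroup.closure {z | ∃ (m : M) (a : A) (x : N), z = (op a • m) ⊗ₜ[ℤ] x - m ⊗ₜ[ℤ] (a • x)}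

/-- The tensor product `M ⊗_A N` of a right `A`-module `M` and a left `A`-module `N`. -/
def BalancedTensor : Type _ := (M ⊗[ℤ] N) ⧸ balancedRel A M N

namespace BalancedTensor

noncomputable instance : AddCommGroup (BalancedTensor A M N) :=
  inferInstanceAs (AddCommGroup ((M ⊗[ℤ] N) ⧸ balancedRel A M N))

variable {M N}

/-- The pure tensor `m ⊗ x` in `M ⊗_A N`. -/
def tmul (m : M) (x : N) : BalancedTensor A M N :=
  QuotientAddGroup.mk' (balancedRel A M N) (m ⊗ₜ[ℤ] x)

variable {A}

theorem tmul_smul (m : M) (a : A) (x : N) : tmul A (op a • m) x = tmul A m (a • x) := by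
  have h : (op a • m) ⊗ₜ[ℤ] x - m ⊗ₜ[ℤ] (a • x) ∈ balancedRel A M N :=
    AddSubgroup.subset_closure ⟨m, a, x, rfl⟩
  have h' := (QuotientAddGroup.eq_zero_iff _).2 h
  rw [QuotientAddGroup.mk_sub] at h'
  exact sub_eq_zero.1 h'

theorem add_tmul (m m' : M) (x : N) : tmul A (m + m') x = tmul A m x + tmul A m' x := by
  simp only [tmul, TensorProduct.add_tmul]
  exact map_add (QuotientAddGroup.mk' (balancedRel A M N)) _ _

theorem tmul_add (m : M) (x x' : N) : tmul A m (x + x') = tmul A m x + tmul A m x' := by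
  simp only [tmul, TensorProduct.tmul_add]
  exact map_add (QuotientAddGroup.mk' (balancedRel A M N)) _ _

theorem zero_tmul (x : N) : tmul A (0 : M) x = 0 := by
  simp only [tmul, TensorProduct.zero_tmul]
  exact map_zero (QuotientAddGroup.mk' (balancedRel A M N))

theorem tmul_zero (m : M) : tmul A m (0 : N) = 0 := by
  simp only [tmul, TensorProduct.tmul_zero]
  exact map_zero (QuotientAddGroup.mk' (balancedRel A M N))

theorem induction {P : BalancedTensor A M N → Prop} (h0 : P 0) (h1 : ∀ m x, P (tmul A m x))
    (h2 : ∀ s t, P s → P t → P (s + t)) (t : BalancedTensor A M N) : P t := by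
  obtain ⟨z, rfl⟩ := QuotientAddGroup.mk'_surjective (balancedRel A M N) t
  induction z using TensorProduct.induction_on with
  | zero => rw [map_zero]; exact h0
  | tmul m x => exact h1 m x
  | add y z hy hz => rw [map_add]; exact h2 _ _ hy hz

/-- The endomorphism of `M ⊗_A N` given by `m ⊗ x ↦ f m ⊗ g x`, for `A`-linear `f` and `g`. -/
noncomputable def map (f : M →ₗ[Aᵐᵒᵖ] M) (g : N →ₗ[A] N) :
    BalancedTensor A M N →+ BalancedTensor A M N :=
  QuotientAddGroup.map (balancedRel A M N) (balancedRel A M N)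
    (TensorProduct.map f.toAddMonoidHom.toIntLinearMap
      g.toAddMonoidHom.toIntLinearMap).toAddMonoidHom (by
    refine (AddSubgroup.closure_le _).2 ?_
    rintro _ ⟨m, a, x, rfl⟩
    refine AddSubgroup.subset_closure ⟨f m, a, g x, ?_⟩
    simp)

theorem map_tmul (f : M →ₗ[Aᵐᵒᵖ] M) (g : N →ₗ[A] N) (m : M) (x : N) :
    map f g (tmul A m x) = tmul A (f m) (g x) := rfl

section Left

variable {R : Type*} [Ring R] [Module R M] [SMulCommClass R Aᵐᵒᵖ M]

/-- If `M` is an `R`-`A`-bimodule, then `R` acts on `M ⊗_A N` by `s (m ⊗ x) = s m ⊗ x`. -/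
noncomputable instance leftSMul : SMul R (BalancedTensor A M N) where
  smul s t := map (Module.toModuleEnd Aᵐᵒᵖ M s) LinearMap.id t

theorem smul_tmul (s : R) (m : M) (x : N) : s • tmul A m x = tmul A (s • m) x := rfl

noncomputable instance leftModule : Module R (BalancedTensor A M N) where
  smul_zero s := map_zero (map (Module.toModuleEnd Aᵐᵒᵖ M s) LinearMap.id)
  smul_add s := map_add (map (Module.toModuleEnd Aᵐᵒᵖ M s) LinearMap.id)
  one_smul t := by
    change map (Module.toModuleEnd Aᵐᵒᵖ M (1 : R)) LinearMap.id t = t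
    induction t using induction with
    | h0 => exact map_zero _
    | h1 m x => rw [map_tmul]; simp
    | h2 s t hs ht => rw [map_add, hs, ht]
  mul_smul s s' t := by
    change map (Module.toModuleEnd Aᵐᵒᵖ M (s * s')) LinearMap.id t =
      map (Module.toModuleEnd Aᵐᵒᵖ M s) LinearMap.id
        (map (Module.toModuleEnd Aᵐᵒᵖ M s') LinearMap.id t)
    induction t using induction with
    | h0 => simp only [map_zero]
    | h1 m x => simp only [map_tmul, LinearMap.id_apply, Module.toModuleEnd_apply, DistribSMul.toLinearMap_apply, mul_smul]
    | h2 s t hs ht => simp only [map_add, hs, ht]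
  add_smul s s' t := by
    change map (Module.toModuleEnd Aᵐᵒᵖ M (s + s')) LinearMap.id t =
      map (Module.toModuleEnd Aᵐᵒᵖ M s) LinearMap.id t +
        map (Module.toModuleEnd Aᵐᵒᵖ M s') LinearMap.id t
    induction t using induction with
    | h0 => simp only [map_zero, add_zero]
    | h1 m x => simp only [map_tmul, LinearMap.id_apply, Module.toModuleEnd_apply, DistribSMul.toLinearMap_apply, add_smul, add_tmul]
    | h2 s t hs ht => rw [AddMonoidHom.map_add, hs, ht, AddMonoidHom.map_add, AddMonoidHom.map_add]; abel
  zero_smul t := by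
    change map (Module.toModuleEnd Aᵐᵒᵖ M (0 : R)) LinearMap.id t = 0
    induction t using induction with
    | h0 => exact map_zero _
    | h1 m x => rw [map_tmul]; simp [zero_tmul]
    | h2 s t hs ht => rw [map_add, hs, ht, add_zero]

end Left

section Right

variable {R : Type*} [Ring R] [Module Rᵐᵒᵖ N] [SMulCommClass Rᵐᵒᵖ A N]

/-- If `N` is an `A`-`R`-bimodule, then `R` acts on the right of `M ⊗_A N` by
`(m ⊗ x) s = m ⊗ x s`. -/
noncomputable instance rightSMul : SMul Rᵐᵒᵖ (BalancedTensor A M N) where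
  smul s t := map LinearMap.id (Module.toModuleEnd A N s) t

theorem op_smul_tmul (s : R) (m : M) (x : N) : op s • tmul A m x = tmul A m (op s • x) := rfl

noncomputable instance rightModule : Module Rᵐᵒᵖ (BalancedTensor A M N) where
  smul_zero s := map_zero (map LinearMap.id (Module.toModuleEnd A N s))
  smul_add s := map_add (map LinearMap.id (Module.toModuleEnd A N s))
  one_smul t := by
    change map LinearMap.id (Module.toModuleEnd A N (1 : Rᵐᵒᵖ)) t = t
    induction t using induction with
    | h0 => exact map_zero _
    | h1 m x => rw [map_tmul]; simp
    | h2 s t hs ht => rw [map_add, hs, ht]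
  mul_smul s s' t := by
    change map LinearMap.id (Module.toModuleEnd A N (s * s')) t =
      map LinearMap.id (Module.toModuleEnd A N s)
        (map LinearMap.id (Module.toModuleEnd A N s') t)
    induction t using induction with
    | h0 => simp only [map_zero]
    | h1 m x => simp only [map_tmul, LinearMap.id_apply, Module.toModuleEnd_apply, DistribSMul.toLinearMap_apply, mul_smul]
    | h2 s t hs ht => simp only [map_add, hs, ht]
  add_smul s s' t := by
    change map LinearMap.id (Module.toModuleEnd A N (s + s')) t =
      map LinearMap.id (Module.toModuleEnd A N s) t +
        map LinearMap.id (Module.toModuleEnd A N s') t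
    induction t using induction with
    | h0 => simp only [map_zero, add_zero]
    | h1 m x => simp only [map_tmul, LinearMap.id_apply, Module.toModuleEnd_apply, DistribSMul.toLinearMap_apply, add_smul, tmul_add]
    | h2 s t hs ht => rw [AddMonoidHom.map_add, hs, ht, AddMonoidHom.map_add, AddMonoidHom.map_add]; abel
  zero_smul t := by
    change map LinearMap.id (Module.toModuleEnd A N (0 : Rᵐᵒᵖ)) t = 0
    induction t using induction with
    | h0 => exact map_zero _
    | h1 m x => rw [map_tmul]; simp [tmul_zero]
    | h2 s t hs ht => rw [map_add, hs, ht, add_zero]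

end Right

end BalancedTensor

end BalancedTensor

/-! ### The bimodules `S e` and `e S` of an idempotent -/

namespace IsIdempotentElem

open MulOpposite

variable {S : Type*} [Ring S] {e : S}

/-- The left ideal `S e = {s e | s ∈ S}`. -/
def LeftIdeal (_ : IsIdempotentElem e) : Submodule S S := Submodule.span S {e}

/-- The right ideal `e S = {e s | s ∈ S}`. -/
def RightIdeal (_ : IsIdempotentElem e) : Submodule Sᵐᵒᵖ S := Submodule.span Sᵐᵒᵖ {e}

theorem mem_leftIdeal (he : IsIdempotentElem e) {x : S} : x ∈ he.LeftIdeal ↔ x * e = x := by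
  rw [LeftIdeal, Submodule.mem_span_singleton]
  constructor
  · rintro ⟨s, rfl⟩
    rw [smul_eq_mul, mul_assoc, he.eq]
  · intro h
    exact ⟨x, h⟩

theorem mem_rightIdeal (he : IsIdempotentElem e) {x : S} : x ∈ he.RightIdeal ↔ e * x = x := by
  rw [RightIdeal, Submodule.mem_span_singleton]
  constructor
  · rintro ⟨s, rfl⟩
    rw [← op_unop s, op_smul_eq_mul, ← mul_assoc, he.eq]
  · intro h
    exact ⟨op x, h⟩

theorem corner_left (he : IsIdempotentElem e) (b : he.Corner) : e * b.1 = b.1 :=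
  ((Subsemigroup.mem_corner_iff he).1 b.2).1

theorem corner_right (he : IsIdempotentElem e) (b : he.Corner) : b.1 * e = b.1 :=
  ((Subsemigroup.mem_corner_iff he).1 b.2).2

/-- The right action of `e S e` on `S e` by multiplication in `S`. -/
instance leftIdealModule (he : IsIdempotentElem e) : Module he.Cornerᵐᵒᵖ he.LeftIdeal where
  smul b x := ⟨x.1 * b.unop.1, he.mem_leftIdeal.2 (by rw [mul_assoc, he.corner_right])⟩
  one_smul x := Subtype.ext (he.mem_leftIdeal.1 x.2)
  mul_smul b c x := Subtype.ext (mul_assoc x.1 c.unop.1 b.unop.1).symm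
  smul_zero b := Subtype.ext (zero_mul b.unop.1)
  smul_add b x y := Subtype.ext (add_mul x.1 y.1 b.unop.1)
  add_smul b c x := Subtype.ext (mul_add x.1 b.unop.1 c.unop.1)
  zero_smul x := Subtype.ext (mul_zero x.1)

/-- The left action of `e S e` on `e S` by multiplication in `S`. -/
instance rightIdealModule (he : IsIdempotentElem e) : Module he.Corner he.RightIdeal where
  smul b x := ⟨b.1 * x.1, he.mem_rightIdeal.2 (by rw [← mul_assoc, he.corner_left])⟩
  one_smul x := Subtype.ext (he.mem_rightIdeal.1 x.2)
  mul_smul b c x := Subtype.ext (mul_assoc b.1 c.1 x.1)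
  smul_zero b := Subtype.ext (mul_zero b.1)
  smul_add b x y := Subtype.ext (mul_add b.1 x.1 y.1)
  add_smul b c x := Subtype.ext (add_mul b.1 c.1 x.1)
  zero_smul x := Subtype.ext (zero_mul x.1)

instance leftIdealComm (he : IsIdempotentElem e) : SMulCommClass S he.Cornerᵐᵒᵖ he.LeftIdeal where
  smul_comm s b x := Subtype.ext (mul_assoc s x.1 b.unop.1).symm

instance rightIdealComm (he : IsIdempotentElem e) :
    SMulCommClass Sᵐᵒᵖ he.Corner he.RightIdeal where
  smul_comm s b x := Subtype.ext (mul_assoc b.1 x.1 s.unop)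

end IsIdempotentElem

namespace AffineSchur

/-- The left ideal `S e_λ`, an `S`-`B`-bimodule. -/
noncomputable abbrev Se : Submodule (AffineSchur 2 2) (AffineSchur 2 2) := eLam_idem.LeftIdeal

/-- The right ideal `e_λ S`, a `B`-`S`-bimodule. -/
noncomputable abbrev eS : Submodule (AffineSchur 2 2)ᵐᵒᵖ (AffineSchur 2 2) :=
  eLam_idem.RightIdeal

end AffineSchur

namespace IsIdempotentElem

open MulOpposite

variable {S : Type*} [Ring S] {e : S}

theorem projective_leftIdeal (he : IsIdempotentElem e) : Module.Projective S he.LeftIdeal :=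
  Module.Projective.of_split he.LeftIdeal.subtype
    ((LinearMap.toSpanSingleton S S e).codRestrict he.LeftIdeal fun s =>
      he.mem_leftIdeal.2 (by simp [mul_assoc, he.eq]))
    (LinearMap.ext fun x => Subtype.ext (by simpa using he.mem_leftIdeal.1 x.2))

theorem projective_rightIdeal (he : IsIdempotentElem e) :
    Module.Projective Sᵐᵒᵖ he.RightIdeal := by
  have : Module.Projective Sᵐᵒᵖ S := Module.Projective.of_equiv
    { opAddEquiv.symm with map_smul' := fun _ _ => rfl : Sᵐᵒᵖ ≃ₗ[Sᵐᵒᵖ] S }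
  exact Module.Projective.of_split he.RightIdeal.subtype
    (LinearMap.codRestrict he.RightIdeal
      { toFun := fun s => e * s
        map_add' := mul_add e
        map_smul' := fun s x => (mul_assoc e x s.unop).symm } fun s =>
      he.mem_rightIdeal.2 (by simp [← mul_assoc, he.eq]))
    (LinearMap.ext fun x => Subtype.ext (by simpa using he.mem_rightIdeal.1 x.2))

theorem mul_mem_span (he : IsIdempotentElem e) (x : he.LeftIdeal) (y : S) :
    (x : S) * y ∈ TwoSidedIdeal.span {e} := by
  rw [← he.mem_leftIdeal.1 x.2]
  exact TwoSidedIdeal.mul_mem_right _ _ _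
    (TwoSidedIdeal.mul_mem_left _ _ _ (TwoSidedIdeal.subset_span rfl))

theorem mul_mem_span' (he : IsIdempotentElem e) (x : S) (y : he.RightIdeal) :
    x * (y : S) ∈ TwoSidedIdeal.span {e} := by
  rw [← he.mem_rightIdeal.1 y.2]
  exact TwoSidedIdeal.mul_mem_left _ _ _
    (TwoSidedIdeal.mul_mem_right _ _ _ (TwoSidedIdeal.subset_span rfl))

/-- The multiplication map `S e ⊗ e S → S e S` over `e S e`. -/
noncomputable def mulTensor (he : IsIdempotentElem e) :
    BalancedTensor he.Corner he.LeftIdeal he.RightIdeal →+ TwoSidedIdeal.span {e} :=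
  QuotientAddGroup.lift (balancedRel he.Corner he.LeftIdeal he.RightIdeal)
    (TensorProduct.liftAddHom
      (AddMonoidHom.mk' (fun x : he.LeftIdeal =>
        AddMonoidHom.mk' (fun y : he.RightIdeal =>
          (⟨(x : S) * (y : S), he.mul_mem_span x y⟩ : TwoSidedIdeal.span {e}))
          fun y y' => Subtype.ext (mul_add (x : S) (y : S) (y' : S)))
        fun x x' => AddMonoidHom.ext fun y => Subtype.ext (add_mul (x : S) (x' : S) (y : S)))
      (fun n x y => Subtype.ext (by simp [mul_assoc, (Int.cast_commute n (x : S)).left_comm])))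
    (by
      refine (AddSubgroup.closure_le _).2 ?_
      rintro _ ⟨m, a, x, rfl⟩
      rw [SetLike.mem_coe, AddMonoidHom.mem_ker, map_sub, sub_eq_zero]
      exact Subtype.ext (mul_assoc (m : S) a.1 (x : S)))

theorem coe_mulTensor_tmul (he : IsIdempotentElem e) (x : he.LeftIdeal) (y : he.RightIdeal) :
    (he.mulTensor (BalancedTensor.tmul he.Corner x y) : S) = x * y := rfl

theorem mulTensor_smul (he : IsIdempotentElem e) (s : S)
    (t : BalancedTensor he.Corner he.LeftIdeal he.RightIdeal) :
    he.mulTensor (s • t) = s • he.mulTensor t := by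
  induction t using BalancedTensor.induction with
  | h0 => simp
  | h1 m x => exact Subtype.ext (mul_assoc s (m : S) (x : S))
  | h2 t t' ht ht' => rw [smul_add, map_add, ht, ht', map_add, smul_add]

theorem mulTensor_op_smul (he : IsIdempotentElem e) (s : S)
    (t : BalancedTensor he.Corner he.LeftIdeal he.RightIdeal) :
    he.mulTensor (op s • t) = op s • he.mulTensor t := by
  induction t using BalancedTensor.induction with
  | h0 => simp
  | h1 m x => exact Subtype.ext (mul_assoc (m : S) (x : S) s).symm
  | h2 t t' ht ht' => rw [smul_add, map_add, ht, ht', map_add, smul_add]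

section Generators

variable {ι : Type*} [Fintype ι]

/-- Left multiples of generators of `e S` over `e S e` exhaust `S e S`. -/
theorem exists_sum_mul (he : IsIdempotentElem e) (y : ι → he.RightIdeal)
    (hgen : ∀ w : S, ∃ b : ι → he.Corner, e * w = ∑ i, (b i).1 * (y i : S))
    {z : S} (hz : z ∈ TwoSidedIdeal.span {e}) :
    ∃ x : ι → he.LeftIdeal, z = ∑ i, (x i : S) * (y i : S) := by
  induction hz using TwoSidedIdeal.span_induction with
  | mem z h =>
    obtain rfl : z = e := h
    obtain ⟨b, hb⟩ := hgen 1
    exact ⟨fun i => ⟨(b i).1, he.mem_leftIdeal.2 (he.corner_right (b i))⟩, by simpa using hb⟩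
  | zero => exact ⟨0, by simp⟩
  | add z z' _ _ h h' =>
    obtain ⟨x, rfl⟩ := h
    obtain ⟨x', rfl⟩ := h'
    exact ⟨x + x', by simp [add_mul, Finset.sum_add_distrib]⟩
  | neg z _ h =>
    obtain ⟨x, rfl⟩ := h
    exact ⟨-x, by simp⟩
  | left_absorb a z _ h =>
    obtain ⟨x, rfl⟩ := h
    exact ⟨a • x, by simp [Finset.mul_sum, mul_assoc]⟩
  | right_absorb a z _ h =>
    obtain ⟨x, rfl⟩ := h
    choose b hb using fun i => hgen (y i * a)
    refine ⟨fun j => ∑ i, op (b i j) • x i, ?_⟩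
    have key : ∀ i, (y i : S) * a = ∑ j, (b i j).1 * (y j : S) := fun i => by
      rw [← hb, ← mul_assoc, he.mem_rightIdeal.1 (y i).2]
    have hs : ∀ i j, ((op (b i j) • x i : he.LeftIdeal) : S) = x i * (b i j).1 := fun _ _ => rfl
    simp only [Finset.sum_mul, mul_assoc, key, Finset.mul_sum, AddSubmonoidClass.coe_finsetSum, hs]
    exact Finset.sum_comm

/-- Right multiples of generators of `S e` over `e S e` exhaust `S e S`. -/
theorem exists_sum_mul' (he : IsIdempotentElem e) (y : ι → he.LeftIdeal)
    (hgen : ∀ w : S, ∃ b : ι → he.Corner, w * e = ∑ i, (y i : S) * (b i).1)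
    {z : S} (hz : z ∈ TwoSidedIdeal.span {e}) :
    ∃ x : ι → he.RightIdeal, z = ∑ i, (y i : S) * (x i : S) := by
  induction hz using TwoSidedIdeal.span_induction with
  | mem z h =>
    obtain rfl : z = e := h
    obtain ⟨b, hb⟩ := hgen 1
    exact ⟨fun i => ⟨(b i).1, he.mem_rightIdeal.2 (he.corner_left (b i))⟩, by simpa using hb⟩
  | zero => exact ⟨0, by simp⟩
  | add z z' _ _ h h' =>
    obtain ⟨x, rfl⟩ := h
    obtain ⟨x', rfl⟩ := h'
    exact ⟨x + x', by simp [mul_add, Finset.sum_add_distrib]⟩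
  | neg z _ h =>
    obtain ⟨x, rfl⟩ := h
    exact ⟨-x, by simp⟩
  | right_absorb a z _ h =>
    obtain ⟨x, rfl⟩ := h
    exact ⟨op a • x, by simp [Finset.sum_mul, mul_assoc]⟩
  | left_absorb a z _ h =>
    obtain ⟨x, rfl⟩ := h
    choose b hb using fun i => hgen (a * y i)
    refine ⟨fun j => ∑ i, b i j • x i, ?_⟩
    have key : ∀ i, a * (y i : S) = ∑ j, (y j : S) * (b i j).1 := fun i => by
      rw [← hb, mul_assoc, he.mem_leftIdeal.1 (y i).2]
    have hs : ∀ i j, ((b i j • x i : he.RightIdeal) : S) = (b i j).1 * x i := fun _ _ => rfl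
    simp only [Finset.mul_sum, ← mul_assoc, key, Finset.sum_mul, AddSubmonoidClass.coe_finsetSum,
      hs]
    exact Finset.sum_comm

/-- If `e S` has generators over `e S e` that are independent over `S e`, then `S e S` is a
finite direct sum of copies of `S e`, so it is projective. -/
theorem projective_span_left (he : IsIdempotentElem e) (y : ι → he.RightIdeal)
    (hgen : ∀ w : S, ∃ b : ι → he.Corner, e * w = ∑ i, (b i).1 * (y i : S))
    (hind : ∀ x : ι → he.LeftIdeal, ∑ i, (x i : S) * (y i : S) = 0 → x = 0) :
    Module.Projective S (TwoSidedIdeal.span {e}) := by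
  let f : (ι → he.LeftIdeal) →ₗ[S] TwoSidedIdeal.span {e} :=
    { toFun := fun x => ∑ i, ⟨(x i : S) * (y i : S), he.mul_mem_span _ _⟩
      map_add' := fun x x' => Subtype.ext (by
        simp [AddSubmonoidClass.coe_finsetSum, add_mul, Finset.sum_add_distrib])
      map_smul' := fun s x => Subtype.ext (by
        simp [AddSubmonoidClass.coe_finsetSum, Finset.mul_sum, mul_assoc]) }
  have hf : ∀ x, (f x : S) = ∑ i, (x i : S) * (y i : S) := fun x =>
    AddSubmonoidClass.coe_finsetSum _ _
  have := he.projective_leftIdeal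
  classical
  refine Module.Projective.of_equiv ((DFinsupp.linearEquivFunOnFintype (R := S)
    (M := fun _ : ι => he.LeftIdeal)).trans (LinearEquiv.ofBijective f ⟨?_, ?_⟩))
  · refine (injective_iff_map_eq_zero f).2 fun x hx => hind x ?_
    rw [← hf, hx]
    rfl
  · intro z
    obtain ⟨x, hx⟩ := he.exists_sum_mul y hgen z.2
    exact ⟨x, Subtype.ext ((hf x).trans hx.symm)⟩

/-- If `S e` has generators over `e S e` that are independent over `e S`, then `S e S` is a
finite direct sum of copies of `e S`, so it is projective. -/
theorem projective_span_right (he : IsIdempotentElem e) (y : ι → he.LeftIdeal)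
    (hgen : ∀ w : S, ∃ b : ι → he.Corner, w * e = ∑ i, (y i : S) * (b i).1)
    (hind : ∀ x : ι → he.RightIdeal, ∑ i, (y i : S) * (x i : S) = 0 → x = 0) :
    Module.Projective Sᵐᵒᵖ (TwoSidedIdeal.span {e}) := by
  let f : (ι → he.RightIdeal) →ₗ[Sᵐᵒᵖ] TwoSidedIdeal.span {e} :=
    { toFun := fun x => ∑ i, ⟨(y i : S) * (x i : S), he.mul_mem_span' _ _⟩
      map_add' := fun x x' => Subtype.ext (by
        simp [AddSubmonoidClass.coe_finsetSum, mul_add, Finset.sum_add_distrib])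
      map_smul' := fun s x => Subtype.ext (by
        change _ = _ * s.unop
        simp [AddSubmonoidClass.coe_finsetSum, Finset.sum_mul, mul_assoc]) }
  have hf : ∀ x, (f x : S) = ∑ i, (y i : S) * (x i : S) := fun x =>
    AddSubmonoidClass.coe_finsetSum _ _
  have := he.projective_rightIdeal
  classical
  refine Module.Projective.of_equiv ((DFinsupp.linearEquivFunOnFintype (R := Sᵐᵒᵖ)
    (M := fun _ : ι => he.RightIdeal)).trans (LinearEquiv.ofBijective f ⟨?_, ?_⟩))
  · refine (injective_iff_map_eq_zero f).2 fun x hx => hind x ?_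
    rw [← hf, hx]
    rfl
  · intro z
    obtain ⟨x, hx⟩ := he.exists_sum_mul' y hgen z.2
    exact ⟨x, Subtype.ext ((hf x).trans hx.symm)⟩

theorem exists_eq_sum_tmul (he : IsIdempotentElem e) (y : ι → he.RightIdeal)
    (hgen : ∀ w : S, ∃ b : ι → he.Corner, e * w = ∑ i, (b i).1 * (y i : S))
    (t : BalancedTensor he.Corner he.LeftIdeal he.RightIdeal) :
    ∃ x : ι → he.LeftIdeal, t = ∑ i, BalancedTensor.tmul he.Corner (x i) (y i) := by
  induction t using BalancedTensor.induction with
  | h0 => exact ⟨0, by simp [BalancedTensor.zero_tmul]⟩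
  | h1 m x =>
    obtain ⟨b, hb⟩ := hgen x
    rw [he.mem_rightIdeal.1 x.2] at hb
    have hx : x = ∑ i, b i • y i :=
      Subtype.ext (hb.trans (AddSubmonoidClass.coe_finsetSum (fun i => b i • y i) _).symm)
    refine ⟨fun i => op (b i) • m, ?_⟩
    simp only [BalancedTensor.tmul_smul]
    rw [hx]
    exact map_sum (AddMonoidHom.mk' (BalancedTensor.tmul he.Corner m) fun u v =>
      BalancedTensor.tmul_add m u v) _ _
  | h2 t t' h h' =>
    obtain ⟨x, rfl⟩ := h
    obtain ⟨x', rfl⟩ := h'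
    exact ⟨x + x', by simp [BalancedTensor.add_tmul, Finset.sum_add_distrib]⟩

theorem mulTensor_bijective (he : IsIdempotentElem e) (y : ι → he.RightIdeal)
    (hgen : ∀ w : S, ∃ b : ι → he.Corner, e * w = ∑ i, (b i).1 * (y i : S))
    (hind : ∀ x : ι → he.LeftIdeal, ∑ i, (x i : S) * (y i : S) = 0 → x = 0) :
    Function.Bijective he.mulTensor := by
  have hf : ∀ x : ι → he.LeftIdeal,
      (he.mulTensor (∑ i, BalancedTensor.tmul he.Corner (x i) (y i)) : S) =
        ∑ i, (x i : S) * (y i : S) := fun x => by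
    rw [map_sum, AddSubmonoidClass.coe_finsetSum]
    rfl
  constructor
  · refine (injective_iff_map_eq_zero he.mulTensor).2 fun t ht => ?_
    obtain ⟨x, rfl⟩ := he.exists_eq_sum_tmul y hgen t
    rw [hind x (by rw [← hf, ht]; rfl)]
    simp [BalancedTensor.zero_tmul]
  · intro z
    obtain ⟨x, hx⟩ := he.exists_sum_mul y hgen z.2
    exact ⟨_, Subtype.ext ((hf x).trans hx.symm)⟩

end Generators

end IsIdempotentElem

namespace AffineSchur

open AffSchur

section Columns

variable {n r : ℕ}

theorem col_ext {f g : AffineSchur n r} (h : ∀ q, f.col q = g.col q) : f = g :=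
  ext_coeff fun c => by
    induction c using orb_ind with
    | h p q => rw [← col_apply, ← col_apply, h]

theorem col_add (f g : AffineSchur n r) (q : Tup r) : (f + g).col q = f.col q + g.col q := by
  ext p
  simp [col_apply, coeff_add]

theorem col_zero (q : Tup r) : (0 : AffineSchur n r).col q = 0 := by
  ext p
  simp [col_apply, coeff_zero]

theorem col_mul (f g : AffineSchur n r) (q : Tup r) : (f * g).col q = f.toEnd (g.col q) := by
  rw [← toEnd_single, toEnd_mul, Module.End.mul_apply, toEnd_single]

theorem coeff_mul_orb (f g : AffineSchur n r) (p q : Tup r) :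
    (f * g).coeff (orb n p q) = ∑ᶠ s, f.coeff (orb n p s) * g.coeff (orb n s q) := by
  rw [← col_apply, col_mul, toEnd, Finsupp.linearCombination_apply, Finsupp.sum,
    Finsupp.finsetSum_apply, finsum_eq_sum_of_support_subset (s := (g.col q).support)]
  · simp [col_apply, mul_comm]
  · intro s hs
    simpa [col_apply] using right_ne_zero_of_mul hs

theorem induction_xi {P : AffineSchur n r → Prop} (h0 : P 0)
    (h1 : ∀ f g, P f → P g → P (f + g)) (h2 : ∀ (x : ℚ) (i j : Tup r), P (x • xi i j))
    (f : AffineSchur n r) : P f := by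
  refine Finsupp.induction_linear (motive := P) f h0 h1 fun c x => ?_
  induction c using orb_ind with
  | h i j =>
    have h : (Finsupp.single (orb n i j) x : AffineSchur n r) = x • xi i j :=
      (Finsupp.smul_single_one (orb n i j) x).symm
    exact h ▸ h2 x i j

end Columns

section Transpose

variable {n r : ℕ}

/-- The orbit of `(j, i)`, given the orbit of `(i, j)`. -/
def flip (c : Orb n r) : Orb n r :=
  Quotient.liftOn c (fun x => orb n x.2 x.1)
    (fun _ _ ⟨σ, ε, h1, h2⟩ => orb_eq_iff.2 ⟨σ, ε, h2, h1⟩)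

theorem flip_orb (p q : Tup r) : flip (orb n p q) = orb n q p := rfl

theorem flip_flip (c : Orb n r) : flip (flip c) = c := by
  induction c using orb_ind with
  | h p q => rfl

/-- The linear anti-involution of the affine Schur algebra exchanging `ξ_{i,j}` and `ξ_{j,i}`. -/
noncomputable def transpose : AffineSchur n r →+ AffineSchur n r where
  toFun f := ofCoeff (fun c => f.coeff (flip c)) ((f.supp.finite_toSet.image flip).subset
    fun c hc => ⟨flip c, mem_supp.2 hc, flip_flip c⟩)
  map_zero' := ext_coeff fun c => by simp only [coeff_zero, coeff_ofCoeff]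
  map_add' f g := ext_coeff fun c => by simp only [coeff_add, coeff_ofCoeff]

theorem coeff_transpose (f : AffineSchur n r) (p q : Tup r) :
    (transpose f).coeff (orb n p q) = f.coeff (orb n q p) := rfl

theorem transpose_transpose (f : AffineSchur n r) : transpose (transpose f) = f :=
  col_ext fun q => by
    ext p
    simp only [col_apply, coeff_transpose]

theorem transpose_mul (f g : AffineSchur n r) :
    transpose (f * g) = transpose g * transpose f :=
  col_ext fun q => by
    ext p
    simp only [col_apply, coeff_transpose, coeff_mul_orb, mul_comm]

theorem transpose_xi (i j : Tup r) : transpose (xi i j : AffineSchur n r) = xi j i := by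
  classical
  refine col_ext fun q => ?_
  ext p
  simp only [col_apply, coeff_transpose, coeff_xi]
  refine if_congr ⟨fun h => ?_, fun h => ?_⟩ rfl rfl <;> simpa only [flip_orb] using congrArg flip h

end Transpose

section TwoTwo

theorem orb_two_eq_iff {a b c d a' b' c' d' : ℤ} :
    orb 2 ![a, b] ![c, d] = orb 2 ![a', b'] ![c', d'] ↔
      (a' - a = c' - c ∧ b' - b = d' - d ∧ (a' - a) % 2 = 0 ∧ (b' - b) % 2 = 0) ∨
      (a' - b = c' - d ∧ b' - a = d' - c ∧ (a' - b) % 2 = 0 ∧ (b' - a) % 2 = 0) := by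
  rw [orb_eq_iff]
  constructor
  · rintro ⟨σ, ε, h1, h2⟩
    have h10 := congrFun h1 0
    have h11 := congrFun h1 1
    have h20 := congrFun h2 0
    have h21 := congrFun h2 1
    have hσ : (σ 0 = 0 ∧ σ 1 = 1) ∨ (σ 0 = 1 ∧ σ 1 = 0) := by
      have hne := σ.injective.ne (show (0 : Fin 2) ≠ 1 by decide)
      generalize σ 0 = x at hne
      generalize σ 1 = y at hne
      revert x y
      decide
    rcases hσ with ⟨h0, h1⟩ | ⟨h0, h1⟩ <;> simp [act, h0, h1] at h10 h11 h20 h21 <;> omega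
  · rintro (⟨h1, h2, h3, h4⟩ | ⟨h1, h2, h3, h4⟩)
    · refine ⟨1, ![(a' - a) / 2, (b' - b) / 2], ?_, ?_⟩ <;> funext t <;> fin_cases t <;>
        simp [act] <;> omega
    · refine ⟨Equiv.swap 0 1, ![(a' - b) / 2, (b' - a) / 2], ?_, ?_⟩ <;> funext t <;>
        fin_cases t <;> simp [act] <;> omega

theorem eq_pair (p : Tup 2) : p = ![p 0, p 1] := by
  funext t; fin_cases t <;> rfl

theorem pair_eq_iff {a b c d : ℤ} : (![a, b] : Tup 2) = ![c, d] ↔ a = c ∧ b = d := by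
  constructor
  · intro h
    exact ⟨congrFun h 0, congrFun h 1⟩
  · rintro ⟨rfl, rfl⟩
    rfl

theorem finsupp_ext_pair {F G : Tup 2 →₀ ℚ} (h : ∀ a b, F ![a, b] = G ![a, b]) : F = G := by
  ext p
  rw [eq_pair p, h]

theorem col_xi_two {a b c d c' d' a' b' : ℤ} :
    (xi ![a, b] ![c, d] : AffineSchur 2 2).col ![c', d'] ![a', b'] =
      if (a' - a = c' - c ∧ b' - b = d' - d ∧ (a' - a) % 2 = 0 ∧ (b' - b) % 2 = 0) ∨
        (a' - b = c' - d ∧ b' - a = d' - c ∧ (a' - b) % 2 = 0 ∧ (b' - a) % 2 = 0)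
      then 1 else 0 := by
  classical
  rw [col_apply, coeff_xi]
  exact if_congr orb_two_eq_iff rfl rfl

theorem single_pair_apply {a b c d : ℤ} :
    Finsupp.single (![a, b] : Tup 2) (1 : ℚ) ![c, d] = if a = c ∧ b = d then 1 else 0 := by
  classical
  rw [Finsupp.single_apply]
  exact if_congr pair_eq_iff rfl rfl

theorem col_xi_two_eq_zero {a b c d c' d' : ℤ}
    (h : ¬ (c % 2 = c' % 2 ∧ d % 2 = d' % 2) ∧ ¬ (c % 2 = d' % 2 ∧ d % 2 = c' % 2)) :
    (xi ![a, b] ![c, d] : AffineSchur 2 2).col ![c', d'] = 0 :=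
  finsupp_ext_pair fun a' b' => by
    rw [col_xi_two, Finsupp.zero_apply, if_neg]
    omega

/-- Every orbit of `𝔖₂ ⋉ ℤ²` on `ℤ²` contains one of `(1, 1)`, `(2, 2)`,
`(1, 2)`, so an element is determined by the corresponding three columns. -/
theorem ext_col_two {f g : AffineSchur 2 2} (h11 : f.col ![1, 1] = g.col ![1, 1])
    (h22 : f.col ![2, 2] = g.col ![2, 2]) (h12 : f.col ![1, 2] = g.col ![1, 2]) : f = g := by
  refine col_ext fun q => finsupp_ext_pair fun a b => ?_
  have aux : ∀ (a' b' c d : ℤ), f.col ![c, d] = g.col ![c, d] →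
      orb 2 ![a, b] ![q 0, q 1] = orb 2 ![a', b'] ![c, d] →
      f.col q ![a, b] = g.col q ![a, b] := fun a' b' c d hcol ho => by
    rw [eq_pair q, col_apply, col_apply, ho, ← col_apply, ← col_apply, hcol]
  rcases Int.emod_two_eq (q 0) with h0 | h0 <;> rcases Int.emod_two_eq (q 1) with h1 | h1
  · exact aux (a - q 0 + 2) (b - q 1 + 2) _ _ h22 (orb_two_eq_iff.2 (by omega))
  · exact aux (b - q 1 + 1) (a - q 0 + 2) _ _ h12 (orb_two_eq_iff.2 (by omega))
  · exact aux (a - q 0 + 1) (b - q 1 + 2) _ _ h12 (orb_two_eq_iff.2 (by omega))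
  · exact aux (a - q 0 + 1) (b - q 1 + 1) _ _ h11 (orb_two_eq_iff.2 (by omega))

theorem col_eLam (q0 q1 : ℤ) : eLam.col ![q0, q1] =
    if q0 % 2 = 1 ∧ q1 % 2 = 1 then Finsupp.single ![q0, q1] 1 else 0 := by
  refine finsupp_ext_pair fun a b => ?_
  rw [eLam, col_xi_two]
  split_ifs with h1 h2 h2
  · rw [single_pair_apply, if_pos (by omega)]
  · omega
  · rw [single_pair_apply, if_neg (by omega)]
  · rfl

theorem transpose_eLam : transpose eLam = eLam := transpose_xi _ _

theorem mul_eLam_col (f : AffineSchur 2 2) (q0 q1 : ℤ) : (f * eLam).col ![q0, q1] =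
    if q0 % 2 = 1 ∧ q1 % 2 = 1 then f.col ![q0, q1] else 0 := by
  rw [col_mul, col_eLam]
  split_ifs
  · rw [toEnd_single]
  · rw [map_zero]

theorem xi_mul_eLam {i : Tup 2} {c d : ℤ} (h : c % 2 = 1 ∧ d % 2 = 1) :
    xi i ![c, d] * eLam = xi i ![c, d] := by
  rw [eq_pair i]
  refine col_ext fun q => ?_
  rw [eq_pair q, mul_eLam_col]
  split_ifs with hq
  · rfl
  · exact (col_xi_two_eq_zero (by omega)).symm

theorem xi_mul_eLam_eq_zero {i : Tup 2} {c d : ℤ} (h : ¬ (c % 2 = 1 ∧ d % 2 = 1)) :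
    xi i ![c, d] * eLam = 0 := by
  rw [eq_pair i]
  refine col_ext fun q => ?_
  rw [eq_pair q, mul_eLam_col, col_zero]
  split_ifs with hq
  · exact col_xi_two_eq_zero (by omega)
  · rfl

theorem eLam_mul_xi {j : Tup 2} {a b : ℤ} (h : a % 2 = 1 ∧ b % 2 = 1) :
    eLam * xi ![a, b] j = xi ![a, b] j := by
  have := congrArg transpose (xi_mul_eLam (i := j) h)
  simpa only [transpose_mul, transpose_xi, transpose_eLam] using this

theorem eLam_mul_xi_eq_zero {j : Tup 2} {a b : ℤ} (h : ¬ (a % 2 = 1 ∧ b % 2 = 1)) :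
    eLam * xi ![a, b] j = 0 := by
  have := congrArg transpose (xi_mul_eLam_eq_zero (i := j) h)
  simpa only [transpose_mul, transpose_xi, transpose_eLam, map_zero] using this

end TwoTwo

end AffineSchur

namespace AffineSchur

open AffSchur

/-- The element of the corner ring `B` given by an element fixed by `e_λ` on both sides. -/
def toCorner (f : AffineSchur 2 2) (h1 : eLam * f = f) (h2 : f * eLam = f) : B :=
  ⟨f, (Subsemigroup.mem_corner_iff eLam_idem).2 ⟨h1, h2⟩⟩

theorem col_xi_self_of_ne {a b c d : ℤ} (h : c % 2 ≠ d % 2) :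
    (xi ![a, b] ![c, d] : AffineSchur 2 2).col ![c, d] = Finsupp.single ![a, b] 1 :=
  finsupp_ext_pair fun a' b' => by
    rw [col_xi_two, single_pair_apply]
    exact if_congr (by omega) rfl rfl

theorem col_xi_self_of_eq {a c : ℤ} :
    (xi ![a, a] ![c, c] : AffineSchur 2 2).col ![c, c] = Finsupp.single ![a, a] 1 :=
  finsupp_ext_pair fun a' b' => by
    rw [col_xi_two, single_pair_apply]
    exact if_congr (by omega) rfl rfl

/-- Column `(1, 2)` of a product with `ξ_{i,(1,2)}`; the other relevant columns vanish. -/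
theorem ext_mul_xi_one_two {f g : AffineSchur 2 2} {a b : ℤ}
    (h11 : g.col ![1, 1] = 0) (h22 : g.col ![2, 2] = 0)
    (h12 : f.col ![a, b] = g.col ![1, 2]) : f * xi ![a, b] ![1, 2] = g := by
  refine ext_col_two ?_ ?_ ?_
  · rw [col_mul, col_xi_two_eq_zero (by omega), map_zero, h11]
  · rw [col_mul, col_xi_two_eq_zero (by omega), map_zero, h22]
  · rw [col_mul, col_xi_self_of_ne (by omega), toEnd_single, h12]

/-- The action of the invariant `(x₁ x₂)^j` on `e_λ S ξ_{(1,2),(1,2)}`. -/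
theorem diag_mul_xi (j a b : ℤ) :
    xi ![1 + 2 * j, 1 + 2 * j] ![1, 1] * xi ![1 + 2 * a, 1 + 2 * b] ![1, 2] =
      (xi ![1 + 2 * (a + j), 1 + 2 * (b + j)] ![1, 2] : AffineSchur 2 2) := by
  refine ext_mul_xi_one_two (col_xi_two_eq_zero (by omega)) (col_xi_two_eq_zero (by omega)) ?_
  rw [col_xi_self_of_ne (by omega)]
  refine finsupp_ext_pair fun a' b' => ?_
  rw [col_xi_two, single_pair_apply]
  exact if_congr (by omega) rfl rfl

/-- The action of the invariant `x₁ + x₂` on `e_λ S ξ_{(1,2),(1,2)}`. -/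
theorem sum_mul_xi (a b : ℤ) :
    xi ![3, 1] ![1, 1] * xi ![1 + 2 * a, 1 + 2 * b] ![1, 2] =
      (xi ![1 + 2 * (a + 1), 1 + 2 * b] ![1, 2] + xi ![1 + 2 * a, 1 + 2 * (b + 1)] ![1, 2] :
        AffineSchur 2 2) := by
  refine ext_mul_xi_one_two ?_ ?_ ?_
  · rw [col_add, col_xi_two_eq_zero (by omega), col_xi_two_eq_zero (by omega), add_zero]
  · rw [col_add, col_xi_two_eq_zero (by omega), col_xi_two_eq_zero (by omega), add_zero]
  · rw [col_add, col_xi_self_of_ne (by omega), col_xi_self_of_ne (by omega)]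
    refine finsupp_ext_pair fun a' b' => ?_
    rw [Finsupp.add_apply, col_xi_two, single_pair_apply, single_pair_apply]
    split_ifs <;> first | omega | norm_num

theorem xi_mul_xi_one_one_two_two (i : Tup 2) :
    xi i ![1, 1] * xi ![1, 1] ![2, 2] = (xi i ![2, 2] : AffineSchur 2 2) := by
  rw [eq_pair i]
  refine ext_col_two ?_ ?_ ?_
  · rw [col_mul, col_xi_two_eq_zero (by omega), map_zero, col_xi_two_eq_zero (by omega)]
  · rw [col_mul, col_xi_self_of_eq, toEnd_single]
    refine finsupp_ext_pair fun a' b' => ?_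
    rw [col_xi_two, col_xi_two]
    exact if_congr (by omega) rfl rfl
  · rw [col_mul, col_xi_two_eq_zero (by omega), map_zero, col_xi_two_eq_zero (by omega)]

/-- The basis element `ξ_{i,j}` of `e_λ S`, for `i` with two odd entries. -/
noncomputable def xiRow {a b : ℤ} (h : a % 2 = 1 ∧ b % 2 = 1) (j : Tup 2) : eS :=
  ⟨xi ![a, b] j, eLam_idem.mem_rightIdeal.2 (eLam_mul_xi h)⟩

/-- The basis element `ξ_{i,j}` of `B`, for `i` and `j` with odd entries. -/
noncomputable def xiCorner {a b c d : ℤ} (h : a % 2 = 1 ∧ b % 2 = 1) (h' : c % 2 = 1 ∧ d % 2 = 1) :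
    B :=
  toCorner (xi ![a, b] ![c, d]) (eLam_mul_xi h) (xi_mul_eLam h')

/-- A basis of `e_λ S` over `B`: it corresponds to the basis
`1`, `1`, `1, x₂` of `ℚ[x₁^±, x₂^±]^{𝔖₂} ⊕ ℚ[x₁^±, x₂^±]^{𝔖₂} ⊕ ℚ[x₁^±, x₂^±]`. -/
noncomputable def rowGen : Fin 4 → eS :=
  ![xiRow (a := 1) (b := 1) (by omega) ![1, 1], xiRow (a := 1) (b := 1) (by omega) ![2, 2],
    xiRow (a := 1 + 2 * 0) (b := 1 + 2 * 0) (by omega) ![1, 2],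
    xiRow (a := 1 + 2 * 0) (b := 1 + 2 * 1) (by omega) ![1, 2]]

/-- The `B`-submodule of `e_λ S` generated by `rowGen`. -/
noncomputable def rowSpan : Submodule B eS := Submodule.span B (Set.range rowGen)

theorem rowGen_mem (i : Fin 4) : rowGen i ∈ rowSpan := Submodule.subset_span ⟨i, rfl⟩

theorem xiRow_zero_mem (k : ℤ) :
    xiRow (a := 1 + 2 * 0) (b := 1 + 2 * k) (by omega) ![1, 2] ∈ rowSpan := by
  have hC : ∀ k : ℤ, xiCorner (a := 3) (b := 1) (c := 1) (d := 1) (by omega) (by omega) •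
      xiRow (a := 1 + 2 * 0) (b := 1 + 2 * k) (by omega) ![1, 2] =
      xiRow (a := 1 + 2 * (0 + 1)) (b := 1 + 2 * k) (by omega) ![1, 2] +
      xiRow (a := 1 + 2 * 0) (b := 1 + 2 * (k + 1)) (by omega) ![1, 2] := fun k =>
    Subtype.ext (sum_mul_xi 0 k)
  have hD : ∀ j a b : ℤ, xiCorner (a := 1 + 2 * j) (b := 1 + 2 * j) (c := 1) (d := 1)
      (by omega) (by omega) • xiRow (a := 1 + 2 * a) (b := 1 + 2 * b) (by omega) ![1, 2] =
      xiRow (a := 1 + 2 * (a + j)) (b := 1 + 2 * (b + j)) (by omega) ![1, 2] := fun j a b =>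
    Subtype.ext (diag_mul_xi j a b)
  have hcongr : ∀ {a b a' b' : ℤ} (ha : a = a') (hb : b = b') (h),
      xiRow (a := 1 + 2 * a) (b := 1 + 2 * b) h ![1, 2] =
        xiRow (a := 1 + 2 * a') (b := 1 + 2 * b') (ha ▸ hb ▸ h) ![1, 2] := by
    rintro a b _ _ rfl rfl h
    rfl
  have key : ∀ k : ℤ, xiRow (a := 1 + 2 * 0) (b := 1 + 2 * k) (by omega) ![1, 2] ∈ rowSpan ∧
      xiRow (a := 1 + 2 * 0) (b := 1 + 2 * (k + 1)) (by omega) ![1, 2] ∈ rowSpan := by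
    intro k
    induction k using Int.induction_on with
    | zero => exact ⟨rowGen_mem 2, rowGen_mem 3⟩
    | succ k ih =>
      refine ⟨ih.2, ?_⟩
      rw [eq_sub_of_add_eq' (hC (k + 1)).symm]
      refine Submodule.sub_mem _ (Submodule.smul_mem _ _ ih.2) ?_
      rw [← hD 1 0 k]
      exact Submodule.smul_mem _ _ ih.1
    | pred k ih =>
      have hk := hC (-k)
      refine ⟨?_, by rw [hcongr rfl (sub_add_cancel (-(k : ℤ)) 1)]; exact ih.1⟩
      rw [hcongr (show (0 : ℤ) = 0 + 1 + -1 by omega) (sub_eq_add_neg (-(k : ℤ)) 1),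
        ← hD (-1) (0 + 1) (-k), eq_sub_of_add_eq hk.symm]
      exact Submodule.smul_mem _ _
        (Submodule.sub_mem _ (Submodule.smul_mem _ _ ih.1) ih.2)
  exact (key k).1

theorem xiRow_mem {a b : ℤ} (h : a % 2 = 1 ∧ b % 2 = 1) (j : Tup 2) :
    xiRow h j ∈ rowSpan := by
  have hmixed : ∀ {a b : ℤ} (h : a % 2 = 1 ∧ b % 2 = 1), xiRow h ![1, 2] ∈ rowSpan := by
    intro a b h
    have : xiRow h ![1, 2] = xiCorner (a := 1 + 2 * ((a - 1) / 2)) (b := 1 + 2 * ((a - 1) / 2))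
        (c := 1) (d := 1) (by omega) (by omega) •
        xiRow (a := 1 + 2 * 0) (b := 1 + 2 * ((b - a) / 2)) (by omega) ![1, 2] := by
      refine Subtype.ext (Eq.trans ?_ (diag_mul_xi ((a - 1) / 2) 0 ((b - a) / 2)).symm)
      exact congrArg (fun i => (xi i ![1, 2] : AffineSchur 2 2)) (pair_eq_iff.2 (by omega))
    rw [this]
    exact Submodule.smul_mem _ _ (xiRow_zero_mem _)
  have hxi : ∀ {a' b' c d : ℤ}, orb 2 ![a, b] j = orb 2 ![a', b'] ![c, d] →
      ∀ h' : a' % 2 = 1 ∧ b' % 2 = 1, xiRow h j = xiRow h' ![c, d] := fun ho h' =>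
    Subtype.ext (congrArg (fun c => (Finsupp.single c 1 : AffineSchur 2 2)) ho)
  rcases Int.emod_two_eq (j 0) with h0 | h0 <;> rcases Int.emod_two_eq (j 1) with h1 | h1
  · have hs : xiRow h j = xiCorner (a := a - j 0 + 2) (b := b - j 1 + 2) (c := 1) (d := 1)
        (by omega) (by omega) • rowGen 1 := by
      refine Subtype.ext (Eq.trans ?_ (xi_mul_xi_one_one_two_two _).symm)
      have : orb 2 ![a, b] j = orb 2 ![a - j 0 + 2, b - j 1 + 2] ![2, 2] := by
        rw [eq_pair j]
        exact orb_two_eq_iff.2 (by simp; omega)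
      exact congrArg (fun c => (Finsupp.single c 1 : AffineSchur 2 2)) this
    rw [hs]
    exact Submodule.smul_mem _ _ (rowGen_mem 1)
  · rw [hxi (a' := b - j 1 + 1) (b' := a - j 0 + 2) (c := 1) (d := 2)
      (by rw [eq_pair j]; exact orb_two_eq_iff.2 (by simp; omega)) (by omega)]
    exact hmixed _
  · rw [hxi (a' := a - j 0 + 1) (b' := b - j 1 + 2) (c := 1) (d := 2)
      (by rw [eq_pair j]; exact orb_two_eq_iff.2 (by simp; omega)) (by omega)]
    exact hmixed _
  · have hs : xiRow h j = xiCorner h (⟨h0, h1⟩ : j 0 % 2 = 1 ∧ j 1 % 2 = 1) • rowGen 0 := by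
      refine Subtype.ext ?_
      change xi ![a, b] j = xi ![a, b] ![j 0, j 1] * eLam
      rw [xi_mul_eLam ⟨h0, h1⟩, ← eq_pair j]
    rw [hs]
    exact Submodule.smul_mem _ _ (rowGen_mem 0)

theorem eLam_mul_mem (w : AffineSchur 2 2) :
    (⟨eLam * w, eLam_idem.mem_rightIdeal.2 (by rw [← mul_assoc, eLam_idem.eq])⟩ : eS) ∈
      rowSpan := by
  have key : ∃ v ∈ rowSpan, eLam * w = v.1 := by
    induction w using induction_xi with
    | h0 => exact ⟨0, zero_mem _, mul_zero _⟩
    | h1 f g hf hg =>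
      obtain ⟨u, hu, hf⟩ := hf
      obtain ⟨v, hv, hg⟩ := hg
      exact ⟨u + v, add_mem hu hv, by rw [mul_add, hf, hg]; rfl⟩
    | h2 x i j =>
      rw [mul_smul_comm, eq_pair i]
      by_cases h : i 0 % 2 = 1 ∧ i 1 % 2 = 1
      · refine ⟨toCorner (x • eLam) (by rw [mul_smul_comm, eLam_idem.eq])
          (by rw [smul_mul_assoc, eLam_idem.eq]) • xiRow h j,
          Submodule.smul_mem _ _ (xiRow_mem h j), ?_⟩
        exact (smul_mul_assoc x eLam (xi ![i 0, i 1] j)).symm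
      · exact ⟨0, zero_mem _, by rw [eLam_mul_xi_eq_zero h, smul_zero]; rfl⟩
  obtain ⟨v, hv, h⟩ := key
  convert hv

theorem exists_eq_sum_rowGen (w : AffineSchur 2 2) :
    ∃ b : Fin 4 → B, eLam * w = ∑ i, (b i).1 * (rowGen i : AffineSchur 2 2) := by
  obtain ⟨b, hb⟩ := (Submodule.mem_span_range_iff_exists_fun B).1 (eLam_mul_mem w)
  refine ⟨b, ?_⟩
  have := congrArg Subtype.val hb.symm
  rw [AddSubmonoidClass.coe_finsetSum] at this
  exact this

theorem eq_zero_of_periodic {F : Tup 2 →₀ ℚ} (h : ∀ a b, F ![a, b] = F ![a + 2, b - 2]) :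
    F = 0 := by
  refine finsupp_ext_pair fun a b => ?_
  by_contra hne
  have hk : ∀ k : ℕ, F ![a + 2 * k, b - 2 * k] = F ![a, b] := by
    intro k
    induction k with
    | zero => simp
    | succ k ih =>
      rw [← ih, h (a + 2 * k)]
      exact congrArg F (pair_eq_iff.2 (by omega))
  refine Set.infinite_of_injective_forall_mem (s := (F.support : Set (Tup 2)))
    (f := fun k : ℕ => (![a + 2 * k, b - 2 * k] : Tup 2)) ?_ ?_ F.support.finite_toSet
  · intro k l hkl
    have := (pair_eq_iff.1 hkl).1
    omega
  · intro k
    rw [Finset.mem_coe, Finsupp.mem_support_iff, hk]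
    exact hne

theorem leftIdeal_ext {x : AffineSchur 2 2} (hx : x * eLam = x) (h : x.col ![1, 1] = 0) :
    x = 0 := by
  refine ext_col_two (by rw [h, col_zero]) ?_ ?_ <;> rw [← hx, mul_eLam_col, col_zero, if_neg] <;>
    omega

theorem rowGen_independent (x : Fin 4 → Se)
    (h : ∑ i, (x i : AffineSchur 2 2) * (rowGen i : AffineSchur 2 2) = 0) : x = 0 := by
  have hx : ∀ i, (x i : AffineSchur 2 2) * eLam = x i := fun i => eLam_idem.mem_leftIdeal.1 (x i).2
  suffices h0 : ∀ i, (x i : AffineSchur 2 2).col ![1, 1] = 0 from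
    funext fun i => Subtype.ext (leftIdeal_ext (hx i) (h0 i))
  rw [Fin.sum_univ_four] at h
  change (x 0).1 * eLam + (x 1).1 * xi ![1, 1] ![2, 2] +
    (x 2).1 * xi ![1 + 2 * 0, 1 + 2 * 0] ![1, 2] +
    (x 3).1 * xi ![1 + 2 * 0, 1 + 2 * 1] ![1, 2] = 0 at h
  have hcol := fun q => congrArg (fun f => f.col q) h
  simp only [col_add, col_mul, col_zero] at hcol
  have h0 : (x 0).1.col ![1, 1] = 0 := by
    have := hcol ![1, 1]
    rw [col_eLam, if_pos (by omega), toEnd_single, col_xi_two_eq_zero (by omega),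
      col_xi_two_eq_zero (by omega), col_xi_two_eq_zero (by omega)] at this
    simpa using this
  have h1 : (x 1).1.col ![1, 1] = 0 := by
    have := hcol ![2, 2]
    rw [col_eLam, if_neg (by omega), col_xi_self_of_eq, toEnd_single,
      col_xi_two_eq_zero (by omega), col_xi_two_eq_zero (by omega)] at this
    simpa using this
  have h23 : (x 2).1.col ![1, 1] + (x 3).1.col ![1, 3] = 0 := by
    have := hcol ![1, 2]
    rw [col_eLam, if_neg (by omega), col_xi_two_eq_zero (by omega), col_xi_self_of_ne (by omega),
      toEnd_single, col_xi_self_of_ne (by omega), toEnd_single] at this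
    simpa using this
  have hsymm : ∀ (f : AffineSchur 2 2) (a b : ℤ), f.col ![1, 1] ![a, b] = f.col ![1, 1] ![b, a] :=
    fun f a b => congrArg f.coeff (orb_two_eq_iff.2 (by omega))
  have hshift : ∀ a b : ℤ, (x 3).1.col ![1, 3] ![a, b] = (x 3).1.col ![1, 1] ![a, b - 2] :=
    fun a b => congrArg (x 3).1.coeff (orb_two_eq_iff.2 (by omega))
  have h23' : ∀ a b : ℤ, (x 2).1.col ![1, 1] ![a, b] = -(x 3).1.col ![1, 1] ![a, b - 2] :=
    fun a b => by
      rw [← hshift]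
      exact eq_neg_of_add_eq_zero_left (DFunLike.congr_fun h23 ![a, b])
  have h3 : (x 3).1.col ![1, 1] = 0 := by
    refine eq_zero_of_periodic fun a b => ?_
    have := hsymm (x 2).1 (a + 2) b
    rw [h23', h23', neg_inj, add_sub_cancel_right] at this
    rw [hsymm, ← this]
  have h2 : (x 2).1.col ![1, 1] = 0 := finsupp_ext_pair fun a b => by
    rw [h23', h3]
    simp
  intro i
  fin_cases i
  exacts [h0, h1, h2, h3]

theorem transpose_mul_eLam {f : AffineSchur 2 2} (h : eLam * f = f) :
    transpose f * eLam = transpose f := by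
  have := congrArg transpose h
  rwa [transpose_mul, transpose_eLam] at this

theorem eLam_mul_transpose {f : AffineSchur 2 2} (h : f * eLam = f) :
    eLam * transpose f = transpose f := by
  have := congrArg transpose h
  rwa [transpose_mul, transpose_eLam] at this

/-- The basis of `S e_λ` over `B` obtained from `rowGen` by the anti-involution. -/
noncomputable def colGen (i : Fin 4) : Se :=
  ⟨transpose (rowGen i : AffineSchur 2 2), eLam_idem.mem_leftIdeal.2 
    (transpose_mul_eLam (eLam_idem.mem_rightIdeal.1 (rowGen i).2))⟩

theorem exists_eq_sum_colGen (w : AffineSchur 2 2) :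
    ∃ b : Fin 4 → B, w * eLam = ∑ i, (colGen i : AffineSchur 2 2) * (b i).1 := by
  obtain ⟨b, hb⟩ := exists_eq_sum_rowGen (transpose w)
  refine ⟨fun i => toCorner (transpose (b i).1)
    (eLam_mul_transpose (eLam_idem.corner_right (b i)))
    (transpose_mul_eLam (eLam_idem.corner_left (b i))), ?_⟩
  have := congrArg transpose hb
  rw [transpose_mul, transpose_transpose, transpose_eLam, map_sum] at this
  simp only [transpose_mul] at this
  exact this

theorem colGen_independent (x : Fin 4 → eS)
    (h : ∑ i, (colGen i : AffineSchur 2 2) * (x i : AffineSchur 2 2) = 0) : x = 0 := by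
  have hx : ∀ i, transpose (x i : AffineSchur 2 2) * eLam = transpose (x i : AffineSchur 2 2) :=
    fun i => transpose_mul_eLam (eLam_idem.mem_rightIdeal.1 (x i).2)
  have h' := congrArg transpose h
  rw [map_sum, map_zero] at h'
  have h0 := rowGen_independent (fun i => ⟨_, eLam_idem.mem_leftIdeal.2 (hx i)⟩) (by
    refine Eq.trans (Finset.sum_congr rfl fun i _ => ?_) h'
    rw [transpose_mul]
    exact congrArg _ (transpose_transpose _).symm)
  refine funext fun i => Subtype.ext ?_
  rw [← transpose_transpose (x i : AffineSchur 2 2)]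
  exact (congrArg transpose (congrArg Subtype.val (congrFun h0 i))).trans (map_zero transpose)

end AffineSchur

theorem proposition4p5 :
    (∃ α : BalancedTensor AffineSchur.B AffineSchur.Se AffineSchur.eS ≃+ AffineSchur.J,
      (∀ (x : AffineSchur.Se) (y : AffineSchur.eS),
        (α (BalancedTensor.tmul AffineSchur.B x y) : AffineSchur 2 2) =
          (x : AffineSchur 2 2) * (y : AffineSchur 2 2)) ∧
      (∀ (s : AffineSchur 2 2)
          (t : BalancedTensor AffineSchur.B AffineSchur.Se AffineSchur.eS),
        α (s • t) = s • α t) ∧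
      (∀ (s : AffineSchur 2 2)
          (t : BalancedTensor AffineSchur.B AffineSchur.Se AffineSchur.eS),
        α (MulOpposite.op s • t) = MulOpposite.op s • α t)) ∧
    Module.Projective (AffineSchur 2 2) AffineSchur.J ∧
    Module.Projective (AffineSchur 2 2)ᵐᵒᵖ AffineSchur.J := by
  refine ⟨⟨AddEquiv.ofBijective AffineSchur.eLam_idem.mulTensor
    (AffineSchur.eLam_idem.mulTensor_bijective AffineSchur.rowGen
      AffineSchur.exists_eq_sum_rowGen AffineSchur.rowGen_independent),
    AffineSchur.eLam_idem.coe_mulTensor_tmul, AffineSchur.eLam_idem.mulTensor_smul,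
    AffineSchur.eLam_idem.mulTensor_op_smul⟩, ?_, ?_⟩
  · exact AffineSchur.eLam_idem.projective_span_left AffineSchur.rowGen
      AffineSchur.exists_eq_sum_rowGen AffineSchur.rowGen_independent
  · exact AffineSchur.eLam_idem.projective_span_right AffineSchur.colGen
      AffineSchur.exists_eq_sum_colGen AffineSchur.colGen_independent
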